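/- Regard a permutation of $[n]=\{1,\dots,n\}$ as a sequence in which each element of $[n]$ appears exactly once. Two sequences $(a_1,\dots,a_L)$ and $(b_1,\dots,b_L)$ are order-isomorphic if $a_i<a_j \iff b_i<b_j$ for all $i,j$. Twins of length $L$ in a permutation are two order-isomorphic (not necessarily contiguous) subsequences of it, of length $L$ each, that have no symbol in common. Theorem. A uniformly random permutation of $[n]$ contains twins of length at least $\tfrac{1}{80}n^{2/3}$ with probability tending to $1$ as $n\to\infty$. This is sharp up to the constant factor: there is a constant $C>0$ such that, with probability tending to $1$ as $n\to\infty$, a uniformly random permutation of $[n]$ contains no twins of length greater than $Cn^{2/3}$. -/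

import Mathlib

open Filter Topology
open scoped ENNReal

namespace PermTwins

/-- Two sequences of the same length `L` are order-isomorphic if their entries
compare in the same way. -/
def OrderIsomorphic {α : Type*} [LinearOrder α] {L : ℕ} (a b : Fin L → α) : Prop :=
  ∀ i j : Fin L, a i < a j ↔ b i < b j

/-- `a` is a subsequence (not necessarily of consecutive entries) of the sequence `c`. -/
def IsSubsequence {α : Type*} {L n : ℕ} (a : Fin L → α) (c : Fin n → α) : Prop :=
  ∃ f : Fin L → Fin n, StrictMono f ∧ ∀ i, a i = c (f i)

/-- The sequences `a`, `b` are twins in `c`: they are order-isomorphic subsequences of `c`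
that have no symbol in common. -/
structure IsTwins {α : Type*} [LinearOrder α] {L n : ℕ}
    (a b : Fin L → α) (c : Fin n → α) : Prop where
  left : IsSubsequence a c
  right : IsSubsequence b c
  orderIsomorphic : OrderIsomorphic a b
  disjoint : ∀ i j : Fin L, a i ≠ b j

/-- The permutation `σ 0, σ 1, …, σ (n - 1)`, regarded as a sequence of symbols,
contains twins of length `L`. The `n` symbols are called `0, …, n - 1`. -/
def HasTwins {n : ℕ} (σ : Equiv.Perm (Fin n)) (L : ℕ) : Prop :=
  ∃ a b : Fin L → Fin n, IsTwins a b (fun i => σ i)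

/-- The probability that a uniformly random permutation of `n` symbols lies in `E`. -/
noncomputable def permProb (n : ℕ) (E : Set (Equiv.Perm (Fin n))) : ℝ≥0∞ :=
  (PMF.uniformOfFintype (Equiv.Perm (Fin n))).toOuterMeasure E

/-- A sequence of events `E n` for a uniformly random permutation of `n` symbols holds
asymptotically almost surely: its probability tends to `1`. -/
def HoldsAAS (E : (n : ℕ) → Set (Equiv.Perm (Fin n))) : Prop :=
  Tendsto (fun n : ℕ => permProb n (E n)) atTop (𝓝 1)

end PermTwins

open scoped Nat

namespace PermTwins

open Equiv Finset

/-! ### Averaging over all permutations -/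

section Averaging

variable {ι α : Type*} [Fintype ι] [Fintype α] [DecidableEq α]

/-! Upper bound: first moment. There are at most `n.choose k ^ 2` ways to place twins of length `k`,
and each placement succeeds with probability at most `1 / k!`. Since `n.choose k ^ 2 / k!` is at
most about `(e³ n² / k³) ^ k`, it tends to `0` for `k = ⌈6 n^(2/3)⌉`.

Lower bound: second moment. Cut the permutation matrix into square cells of side `w`, about `n^(1/3)
/ 3`. From each pair of entries in a common cell give one entry to each twin. If no two chosen pairs
share a block of positions or of symbols, all comparisons between pairs are decided by blocks, so
the choice gives twins (`isTwinSet_isolatedPairs`). The expected number of pairs is about `w² / 2`;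
the pairs that meet another pair cost only a small fraction of this, so the mean of `twinNumber` is
at least `n^(2/3) / 40` (`le_sum_twinNumber`). Swapping two symbols changes `twinNumber` by at most
`2`, so its variance is at most `4n` (`sum_sq_sub_mean_le`), and Chebyshev's inequality gives half
the mean with probability tending to `1`. -/

theorem card_smul_mem_eq (g g' : ι ↪ α) (Q : Finset (ι ↪ α)) :
    #{σ : Perm α | σ • g ∈ Q} = #{σ : Perm α | σ • g' ∈ Q} := by
  obtain ⟨τ, rfl⟩ := Equiv.Perm.exists_smul_eq_embedding g' g
  refine Finset.card_bij (fun σ _ => σ * τ) ?_ ?_ ?_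
  · intro σ hσ
    simpa [mul_smul] using hσ
  · intro a _ b _ h
    exact mul_right_cancel h
  · intro σ hσ
    refine ⟨σ * τ⁻¹, ?_, by simp⟩
    simpa [mul_smul] using hσ

/-- By transitivity of the action on embeddings, the image of a fixed `g` under a uniform
permutation is a uniform embedding; the proof double counts over all `g'`. -/
theorem card_embedding_mul_card_smul_mem (g : ι ↪ α) (Q : Finset (ι ↪ α)) :
    Fintype.card (ι ↪ α) * #{σ : Perm α | σ • g ∈ Q} = Fintype.card (Perm α) * #Q := by
  have h1 : ∑ g' : ι ↪ α, #{σ : Perm α | σ • g' ∈ Q}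
      = Fintype.card (ι ↪ α) * #{σ : Perm α | σ • g ∈ Q} := by
    rw [Finset.sum_congr rfl fun g' _ => card_smul_mem_eq g' g Q]
    simp
  have h2 : ∀ σ : Perm α, #{g' : ι ↪ α | σ • g' ∈ Q} = #Q := by
    intro σ
    refine Finset.card_bij (fun g' _ => σ • g') ?_ ?_ ?_
    · intro g' hg'
      simpa using hg'
    · intro a _ b _ h
      exact smul_left_cancel σ h
    · intro q hq
      exact ⟨σ⁻¹ • q, by simpa using hq, by simp⟩
  rw [← h1]
  simp only [Finset.card_filter]
  rw [Finset.sum_comm]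
  simp only [← Finset.card_filter, h2]
  simp

theorem sum_card_smul_mem_mul (P Q : Finset (ι ↪ α)) :
    (∑ σ : Perm α, #{g ∈ P | σ • g ∈ Q}) * Fintype.card (ι ↪ α)
      = Fintype.card (Perm α) * (#P * #Q) := by
  have h : ∑ σ : Perm α, #{g ∈ P | σ • g ∈ Q} = ∑ g ∈ P, #{σ : Perm α | σ • g ∈ Q} := by
    simp only [Finset.card_filter]
    rw [Finset.sum_comm]
  rw [h, Finset.sum_mul]
  have : ∀ g ∈ P, #{σ : Perm α | σ • g ∈ Q} * Fintype.card (ι ↪ α)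
      = Fintype.card (Perm α) * #Q := by
    intro g _
    rw [mul_comm, card_embedding_mul_card_smul_mem]
  rw [Finset.sum_congr rfl this]
  simp
  ring

end Averaging

/-! ### Variance of a Lipschitz function of a random permutation -/

theorem sum_sq_sub_eq {β : Type*} [Fintype β] [Nonempty β] (x : β → ℝ) (c : ℝ) :
    ∑ i, (x i - c) ^ 2 = ∑ i, (x i - (∑ j, x j) / Fintype.card β) ^ 2
      + Fintype.card β * ((∑ j, x j) / Fintype.card β - c) ^ 2 := by
  set m := (∑ j, x j) / Fintype.card β with hm
  have hN : (Fintype.card β : ℝ) ≠ 0 := by simp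
  have h0 : ∑ i, (x i - m) = 0 := by
    rw [Finset.sum_sub_distrib]
    simp [hm]
    field_simp
    simp
  have h1 : ∀ i, (x i - c) ^ 2 = (x i - m) ^ 2 + 2 * (m - c) * (x i - m) + (m - c) ^ 2 := by
    intro i; ring
  rw [Finset.sum_congr rfl fun i _ => h1 i, Finset.sum_add_distrib, Finset.sum_add_distrib,
    ← Finset.mul_sum, h0]
  simp

/-- Here `p` is the image of `0`. A swap inside the fibre over `p` is a swap of the whole
permutation, so restrictions to fibres inherit the Lipschitz bound. -/
theorem decomposeFin_symm_swap_mul {n : ℕ} (p : Fin (n + 1)) (a b : Fin n) (e : Perm (Fin n)) :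
    Equiv.Perm.decomposeFin.symm (p, swap a b * e)
      = swap (swap 0 p a.succ) (swap 0 p b.succ) * Equiv.Perm.decomposeFin.symm (p, e) := by
  ext x : 1
  refine Fin.cases ?_ (fun i => ?_) x
  · have h (c : Fin n) : p ≠ swap 0 p c.succ := by
      rw [Ne, eq_comm, Equiv.swap_apply_eq_iff]
      simp
    simp [swap_apply_of_ne_of_ne (h a) (h b)]
  · simp only [Equiv.Perm.decomposeFin_symm_apply_succ, Perm.mul_apply]
    have hs : (swap a b (e i)).succ = swap a.succ b.succ (e i).succ :=
      (Fin.succ_injective n).swap_apply a b (e i) |>.symm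
    rw [hs]
    exact ((swap 0 p).injective.swap_apply a.succ b.succ (e i).succ).symm

theorem decomposeFin_symm_eq_swap_mul {n : ℕ} (p : Fin (n + 1)) (e : Perm (Fin n)) :
    Equiv.Perm.decomposeFin.symm (p, e) = swap 0 p * Equiv.Perm.decomposeFin.symm (0, e) := by
  ext x : 1
  refine Fin.cases ?_ (fun i => ?_) x <;> simp

/-- Induction by the law of total variance, conditioning on the image of `0`: each fibre contributes
at most `K² n`, and the conditional means add at most `K²`. -/
theorem sum_sq_sub_mean_le {K : ℝ} (n : ℕ) (f : Perm (Fin n) → ℝ)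
    (hf : ∀ a b σ, |f (swap a b * σ) - f σ| ≤ K) :
    ∑ σ, (f σ - (∑ τ, f τ) / n !) ^ 2 ≤ K ^ 2 * n * n ! := by
  induction n with
  | zero => simp
  | succ n ih =>
    set F : Fin (n + 1) → Perm (Fin n) → ℝ :=
      fun p e => f (Equiv.Perm.decomposeFin.symm (p, e)) with hF
    have hsum : ∀ h : Perm (Fin (n + 1)) → ℝ,
        ∑ σ, h σ = ∑ p, ∑ e, h (Equiv.Perm.decomposeFin.symm (p, e)) := by
      intro h
      rw [← Equiv.sum_comp Equiv.Perm.decomposeFin.symm, Fintype.sum_prod_type]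
    set A : Fin (n + 1) → ℝ := fun p => (∑ e, F p e) / n ! with hA
    have hn : (0 : ℝ) < n ! := by positivity
    have hcard : (Fintype.card (Perm (Fin n)) : ℝ) = n ! := by
      simp [Fintype.card_perm]
    set m := (∑ τ, f τ) / ((n + 1)! : ℝ) with hm
    have hmean : (∑ p, A p) / Fintype.card (Fin (n + 1)) = m := by
      rw [hm, hsum, hA, ← Finset.sum_div, Nat.factorial_succ]
      simp [div_div, hF, mul_comm]
    have hin : ∀ p, ∑ e, (F p e - m) ^ 2 ≤ K ^ 2 * n * n ! + n ! * (A p - m) ^ 2 := by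
      intro p
      rw [sum_sq_sub_eq, hcard]
      gcongr
      refine ih (F p) fun a b e => ?_
      simp only [hF, decomposeFin_symm_swap_mul]
      exact hf _ _ _
    -- Left multiplication by `swap 0 p` matches the fibre over `0` with the fibre over `p`.
    have hA0 : ∀ p, (A p - A 0) ^ 2 ≤ K ^ 2 := by
      intro p
      have habs : |A p - A 0| ≤ K := by
        rw [hA]
        simp only
        rw [← sub_div, ← Finset.sum_sub_distrib, abs_div, abs_of_pos hn, div_le_iff₀ hn]
        calc |∑ e, (F p e - F 0 e)| ≤ ∑ e, |F p e - F 0 e| := Finset.abs_sum_le_sum_abs _ _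
          _ ≤ ∑ _e : Perm (Fin n), K := by
              refine Finset.sum_le_sum fun e _ => ?_
              simp only [hF]
              rw [decomposeFin_symm_eq_swap_mul p e]
              exact hf _ _ _
          _ = K * n ! := by simp [Fintype.card_perm, mul_comm]
      exact sq_le_sq' (abs_le.mp habs).1 (abs_le.mp habs).2
    have hout : ∑ p, (A p - m) ^ 2 ≤ (n + 1) * K ^ 2 := by
      -- The second moment about the mean is at most that about `A 0`.
      have h1 := sum_sq_sub_eq A (A 0)
      rw [hmean] at h1
      have h2 : ∑ p, (A p - A 0) ^ 2 ≤ (n + 1) * K ^ 2 := by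
        calc _ ≤ ∑ _p : Fin (n + 1), K ^ 2 := Finset.sum_le_sum fun p _ => hA0 p
          _ = _ := by simp
      have h3 : 0 ≤ (Fintype.card (Fin (n + 1)) : ℝ) * (m - A 0) ^ 2 := by positivity
      linarith
    rw [hsum]
    calc ∑ p, ∑ e, (F p e - m) ^ 2
        ≤ ∑ p, (K ^ 2 * n * n ! + n ! * (A p - m) ^ 2) := Finset.sum_le_sum fun p _ => hin p
      _ = (n + 1) * (K ^ 2 * n * n !) + n ! * ∑ p, (A p - m) ^ 2 := by
          rw [Finset.sum_add_distrib, Finset.sum_const, Finset.card_univ, Fintype.card_fin,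
            nsmul_eq_mul, ← Finset.mul_sum]
          push_cast
          ring
      _ ≤ (n + 1) * (K ^ 2 * n * n !) + n ! * ((n + 1) * K ^ 2) := by gcongr
      _ = K ^ 2 * (n + 1 : ℕ) * ((n + 1)! : ℝ) := by
          rw [Nat.factorial_succ]; push_cast; ring

open scoped Classical in
-- Chebyshev: where `f σ < s`, the value lies more than `t` below the mean.
theorem card_lt_mul_sq_le {K : ℝ} (n : ℕ) (f : Perm (Fin n) → ℝ)
    (hf : ∀ a b σ, |f (swap a b * σ) - f σ| ≤ K) {s t : ℝ} (ht : 0 ≤ t)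
    (hs : (s + t) * n ! ≤ ∑ σ, f σ) :
    (#{σ | f σ < s} : ℝ) * t ^ 2 ≤ K ^ 2 * n * n ! := by
  have hn : (0 : ℝ) < n ! := by positivity
  refine le_trans ?_ (sum_sq_sub_mean_le n f hf)
  have hm : s + t ≤ (∑ σ, f σ) / n ! := by rwa [le_div_iff₀ hn]
  calc (#{σ | f σ < s} : ℝ) * t ^ 2 = ∑ σ with f σ < s, t ^ 2 := by simp
    _ ≤ ∑ σ with f σ < s, (f σ - (∑ τ, f τ) / n !) ^ 2 := by
        refine Finset.sum_le_sum fun σ hσ => ?_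
        have : f σ < s := by simpa using hσ
        nlinarith
    _ ≤ _ := Finset.sum_le_sum_of_subset_of_nonneg (Finset.filter_subset _ _)
        fun _ _ _ => sq_nonneg _

/-! ### A criterion for events to hold asymptotically almost surely -/

open scoped Classical in
theorem permProb_eq (n : ℕ) (E : Set (Perm (Fin n))) :
    permProb n E = (#{σ | σ ∈ E} : ℝ≥0∞) / n ! := by
  rw [permProb, PMF.toOuterMeasure_uniformOfFintype_apply, Fintype.card_perm, Fintype.card_fin,
    Fintype.card_subtype]

open scoped Classical in
theorem holdsAAS_of_card_compl_le {E : (n : ℕ) → Set (Perm (Fin n))} {b : ℕ → ℝ}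
    (hb : Tendsto b atTop (𝓝 0))
    (hE : ∀ᶠ n in atTop, (#{σ | σ ∉ E n} : ℝ) ≤ b n * n !) : HoldsAAS E := by
  have hlim : Tendsto (fun n => ENNReal.ofReal (1 - b n)) atTop (𝓝 1) := by
    have := (ENNReal.continuous_ofReal.tendsto _).comp (hb.const_sub 1)
    simpa [Function.comp_def] using this
  refine tendsto_of_tendsto_of_tendsto_of_le_of_le' hlim tendsto_const_nhds ?_ ?_
  · filter_upwards [hE] with n hn
    have hpos : (0 : ℝ) < n ! := by positivity
    have hadd : (#{σ | σ ∈ E n} : ℝ) + #{σ | σ ∉ E n} = n ! := by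
      have := Finset.card_filter_add_card_filter_not (s := (Finset.univ : Finset (Perm (Fin n))))
        (fun σ => σ ∈ E n)
      rw [Finset.card_univ, Fintype.card_perm, Fintype.card_fin] at this
      exact_mod_cast this
    rw [permProb_eq]
    have h1 : 1 - b n ≤ (#{σ | σ ∈ E n} : ℝ) / n ! := by
      rw [le_div_iff₀ hpos]
      linarith
    refine (ENNReal.ofReal_le_ofReal h1).trans ?_
    rw [ENNReal.ofReal_div_of_pos hpos, ENNReal.ofReal_natCast, ENNReal.ofReal_natCast]
  · refine Eventually.of_forall fun n => ?_
    show permProb n (E n) ≤ 1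
    rw [permProb_eq]
    refine ENNReal.div_le_of_le_mul ?_
    rw [one_mul]
    have := Finset.card_le_univ ({σ | σ ∈ E n} : Finset (Perm (Fin n)))
    rw [Fintype.card_perm, Fintype.card_fin] at this
    exact_mod_cast this

/-! ### The first moment upper bound -/

theorem HasTwins.mono {n k L : ℕ} {σ : Perm (Fin n)} (h : HasTwins σ L) (hk : k ≤ L) :
    HasTwins σ k := by
  obtain ⟨a, b, ⟨⟨f, hf, haf⟩, ⟨g, hg, hbg⟩, hab, hd⟩⟩ := h
  refine ⟨a ∘ Fin.castLE hk, b ∘ Fin.castLE hk, ⟨⟨f ∘ Fin.castLE hk, hf.comp fun i j h => h,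
    fun i => haf _⟩, ⟨g ∘ Fin.castLE hk, hg.comp fun i j h => h, fun i => hbg _⟩,
    fun i j => hab _ _, fun i j => hd _ _⟩⟩

/-- Reordering the values of `h` does not change the rank of a value among them, and the rank
determines the value. -/
theorem eq_of_comp_lt_iff {k : ℕ} {α : Type*} [LinearOrder α] {h : Fin k → α}
    (hh : Function.Injective h) {π π' : Perm (Fin k)}
    (H : ∀ i j, h (π i) < h (π j) ↔ h (π' i) < h (π' j)) : π = π' := by
  have rank : ∀ (ρ : Perm (Fin k)) (x : α),
      #{j | h (ρ j) < x} = #{j | h j < x} := by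
    intro ρ x
    refine Finset.card_bij (fun j _ => ρ j) ?_ ?_ ?_
    · intro j hj; simpa using hj
    · intro _ _ _ _ e; exact ρ.injective e
    · intro j hj
      exact ⟨ρ⁻¹ j, by simpa using hj, by simp⟩
  have mono : ∀ i j, h i < h j → #{l | h l < h i} < #{l | h l < h j} := by
    intro i j hij
    refine Finset.card_lt_card ⟨fun l hl => ?_, fun hsub => ?_⟩
    · simp only [Finset.mem_filter, Finset.mem_univ, true_and] at hl ⊢
      exact hl.trans hij
    · have : i ∈ ({l | h l < h i} : Finset (Fin k)) := hsub (by simpa using hij)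
      simp at this
  ext1 i
  have hrank : #{l | h l < h (π i)} = #{l | h l < h (π' i)} := by
    rw [← rank π, ← rank π']
    simp only [H]
  rcases lt_trichotomy (h (π i)) (h (π' i)) with hlt | heq | hlt
  · exact absurd hrank (mono _ _ hlt).ne
  · exact hh heq
  · exact absurd hrank (mono _ _ hlt).ne'

/-- Rearranging the entries of `σ` at the positions `g` by any `π` loses no information: the
untouched entries at `f` record the original pattern at `g`, which recovers `π` and then `σ`. -/
theorem card_orderIsomorphic_comp_mul_le {n k : ℕ} (f g : Fin k ↪ Fin n)
    (hfg : ∀ i j, f i ≠ g j) :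
    #{σ : Perm (Fin n) | ∀ i j, σ (f i) < σ (f j) ↔ σ (g i) < σ (g j)} * k ! ≤ n ! := by
  set S : Finset (Perm (Fin n)) := {σ | ∀ i j, σ (f i) < σ (f j) ↔ σ (g i) < σ (g j)} with hS
  have hcard : #(S ×ˢ (Finset.univ : Finset (Perm (Fin k)))) = #S * k ! := by
    rw [Finset.card_product, Finset.card_univ, Fintype.card_perm, Fintype.card_fin]
  have huniv : #(Finset.univ : Finset (Perm (Fin n))) = n ! := by
    rw [Finset.card_univ, Fintype.card_perm, Fintype.card_fin]
  rw [← hcard, ← huniv]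
  refine Finset.card_le_card_of_injOn (fun x => x.1 * x.2.viaFintypeEmbedding g)
    (fun _ _ => Finset.mem_coe.mpr (Finset.mem_univ _)) ?_
  rintro ⟨σ, π⟩ hx ⟨σ', π'⟩ hy he
  have hσ : ∀ i j, σ (f i) < σ (f j) ↔ σ (g i) < σ (g j) := by
    simpa [hS] using hx
  have hσ' : ∀ i j, σ' (f i) < σ' (f j) ↔ σ' (g i) < σ' (g j) := by
    simpa [hS] using hy
  simp only at he
  have hf : ∀ i, σ (f i) = σ' (f i) := by
    intro i
    have := congrArg (fun τ : Perm (Fin n) => τ (f i)) he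
    have hni : f i ∉ Set.range g := by
      rintro ⟨j, hj⟩
      exact hfg i j hj.symm
    simpa [Equiv.Perm.viaFintypeEmbedding_apply_notMem_range _ _ hni] using this
  have hg : ∀ i, σ (g (π i)) = σ' (g (π' i)) := by
    intro i
    have := congrArg (fun τ : Perm (Fin n) => τ (g i)) he
    simpa [Equiv.Perm.viaFintypeEmbedding_apply_image] using this
  have hπ : π = π' := by
    refine eq_of_comp_lt_iff (σ.injective.comp f.injective) ?_
    intro i j
    simp only [Function.comp_apply]
    rw [hσ, hg, hg, ← hσ', hf, hf]
  subst hπ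
  have := mul_right_cancel he
  rw [this]

open scoped Classical in
theorem card_hasTwins_mul_factorial_le (n k : ℕ) :
    #{σ : Perm (Fin n) | HasTwins σ k} * k ! ≤ n.choose k ^ 2 * n ! := by
  set T := {s : Finset (Fin n) // #s = k}
  set A : T × T → Finset (Perm (Fin n)) := fun x =>
    if ∀ i j, x.1.1.orderEmbOfFin x.1.2 i ≠ x.2.1.orderEmbOfFin x.2.2 j then
      Finset.univ.filter fun σ : Perm (Fin n) => ∀ i j, σ (x.1.1.orderEmbOfFin x.1.2 i) <
          σ (x.1.1.orderEmbOfFin x.1.2 j) ↔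
        σ (x.2.1.orderEmbOfFin x.2.2 i) < σ (x.2.1.orderEmbOfFin x.2.2 j)
    else ∅ with hA
  have hsub : ({σ | HasTwins σ k} : Finset (Perm (Fin n))) ⊆ Finset.univ.biUnion A := by
    intro σ hσ
    obtain ⟨a, b, ⟨⟨f, hf, haf⟩, ⟨g, hg, hbg⟩, hab, hd⟩⟩ := (Finset.mem_filter.mp hσ).2
    have hfc : #(Finset.univ.image f) = k := by
      rw [Finset.card_image_of_injective _ hf.injective]; simp
    have hgc : #(Finset.univ.image g) = k := by
      rw [Finset.card_image_of_injective _ hg.injective]; simp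
    have hfe : f = (Finset.univ.image f).orderEmbOfFin hfc :=
      Finset.orderEmbOfFin_unique hfc (fun i => by simp) hf
    have hge : g = (Finset.univ.image g).orderEmbOfFin hgc :=
      Finset.orderEmbOfFin_unique hgc (fun i => by simp) hg
    refine Finset.mem_biUnion.mpr ⟨(⟨_, hfc⟩, ⟨_, hgc⟩), Finset.mem_univ _, ?_⟩
    simp only [hA]
    rw [← hfe, ← hge, if_pos]
    · simp only [Finset.mem_filter, Finset.mem_univ, true_and]
      intro i j
      simpa only [OrderIsomorphic, haf, hbg] using hab i j
    · intro i j hij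
      exact hd i j (by rw [haf, hbg, hij])
  have hone : ∀ x, #(A x) * k ! ≤ n ! := by
    intro x
    simp only [hA]
    split_ifs with h
    · exact card_orderIsomorphic_comp_mul_le (x.1.1.orderEmbOfFin x.1.2).toEmbedding
        (x.2.1.orderEmbOfFin x.2.2).toEmbedding h
    · simp
  have hT : Fintype.card T = n.choose k := by
    simp [T]
  calc #{σ : Perm (Fin n) | HasTwins σ k} * k !
      ≤ (∑ x, #(A x)) * k ! :=
        Nat.mul_le_mul_right _ ((Finset.card_le_card hsub).trans Finset.card_biUnion_le)
    _ = ∑ x, #(A x) * k ! := Finset.sum_mul _ _ _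
    _ ≤ ∑ _x : T × T, n ! := Finset.sum_le_sum fun x _ => hone x
    _ = n.choose k ^ 2 * n ! := by
        rw [Finset.sum_const, Finset.card_univ, Fintype.card_prod, hT, smul_eq_mul, sq]

theorem choose_sq_div_factorial_le {n k : ℕ} (hk : 0 < k) (h : 216 * (n : ℝ) ^ 2 ≤ (k : ℝ) ^ 3) :
    (n.choose k : ℝ) ^ 2 / k ! ≤ (1 / 2) ^ k := by
  have hkf : (0 : ℝ) < k ! := by positivity
  have hk0 : (0 : ℝ) < k := by positivity
  have h1 : (n.choose k : ℝ) ≤ (n : ℝ) ^ k / k ! := Nat.choose_le_pow_div k n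
  have h2 : (k : ℝ) ^ k / k ! ≤ Real.exp 1 ^ k := by
    have := Real.pow_div_factorial_le_exp (k : ℝ) hk0.le k
    rwa [← Real.exp_one_pow] at this
  -- With `216 = 6³`, the ratio below is at most `27 / 216 = 1 / 8`.
  have h3 : Real.exp 1 ^ 3 ≤ 27 := by
    have he : Real.exp 1 ≤ 3 := Real.exp_one_lt_three.le
    calc Real.exp 1 ^ 3 ≤ 3 ^ 3 := by gcongr
      _ = 27 := by norm_num
  have h4 : (n : ℝ) ^ 2 * Real.exp 1 ^ 3 / (k : ℝ) ^ 3 ≤ 1 / 2 := by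
    rw [div_le_iff₀ (by positivity)]
    nlinarith [sq_nonneg (n : ℝ)]
  calc (n.choose k : ℝ) ^ 2 / k ! ≤ ((n : ℝ) ^ k / k !) ^ 2 / k ! := by gcongr
    _ = ((n : ℝ) ^ 2 / (k : ℝ) ^ 3) ^ k * ((k : ℝ) ^ k / k !) ^ 3 := by
        rw [div_pow ((n : ℝ) ^ 2), ← pow_mul, ← pow_mul]
        field_simp
        ring
    _ ≤ ((n : ℝ) ^ 2 / (k : ℝ) ^ 3) ^ k * (Real.exp 1 ^ k) ^ 3 := by gcongr
    _ = ((n : ℝ) ^ 2 * Real.exp 1 ^ 3 / (k : ℝ) ^ 3) ^ k := by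
        rw [← pow_mul, mul_comm k 3, pow_mul, ← mul_pow]
        congr 1
        ring
    _ ≤ (1 / 2) ^ k := by gcongr

theorem rpow_two_thirds_pow_three (n : ℕ) : ((n : ℝ) ^ (2 / 3 : ℝ)) ^ 3 = (n : ℝ) ^ 2 := by
  rw [← Real.rpow_natCast, ← Real.rpow_mul (by positivity)]
  norm_num

theorem holdsAAS_twins_length_le :
    HoldsAAS (fun n => {σ | ∀ L : ℕ, HasTwins σ L → (L : ℝ) ≤ 6 * (n : ℝ) ^ (2 / 3 : ℝ)}) := by
  classical
  set k : ℕ → ℕ := fun n => ⌈6 * (n : ℝ) ^ (2 / 3 : ℝ)⌉₊ with hk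
  have hktop : Tendsto k atTop atTop := by
    refine tendsto_nat_ceil_atTop.comp (Tendsto.const_mul_atTop (by norm_num) ?_)
    exact (tendsto_rpow_atTop (by norm_num)).comp tendsto_natCast_atTop_atTop
  have hb : Tendsto (fun n => (1 / 2 : ℝ) ^ k n) atTop (𝓝 0) :=
    (tendsto_pow_atTop_nhds_zero_of_lt_one (by norm_num) (by norm_num)).comp hktop
  refine holdsAAS_of_card_compl_le hb ?_
  filter_upwards [hktop.eventually_gt_atTop 0] with n hn
  have hsub : ({σ | σ ∉ {σ : Perm (Fin n) | ∀ L : ℕ, HasTwins σ L →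
      (L : ℝ) ≤ 6 * (n : ℝ) ^ (2 / 3 : ℝ)}} : Finset (Perm (Fin n)))
      ⊆ ({σ | HasTwins σ (k n)} : Finset (Perm (Fin n))) := by
    intro σ hσ
    simp only [Set.mem_ofPred_eq, Finset.mem_filter, Finset.mem_univ, true_and, not_forall,
      not_le] at hσ ⊢
    obtain ⟨L, hL, hlt⟩ := hσ
    exact hL.mono (Nat.ceil_le.mpr hlt.le)
  have hcube : 216 * (n : ℝ) ^ 2 ≤ (k n : ℝ) ^ 3 := by
    rw [← rpow_two_thirds_pow_three]
    calc 216 * ((n : ℝ) ^ (2 / 3 : ℝ)) ^ 3 = (6 * (n : ℝ) ^ (2 / 3 : ℝ)) ^ 3 := by ring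
      _ ≤ (k n : ℝ) ^ 3 := by
          gcongr
          exact Nat.le_ceil _
  have hmain : (#{σ : Perm (Fin n) | HasTwins σ (k n)} : ℝ) * (k n)! ≤
      (n.choose (k n) : ℝ) ^ 2 * n ! := by
    exact_mod_cast card_hasTwins_mul_factorial_le n (k n)
  calc _ ≤ (#{σ : Perm (Fin n) | HasTwins σ (k n)} : ℝ) := by
        exact_mod_cast Finset.card_le_card hsub
    _ ≤ (n.choose (k n) : ℝ) ^ 2 / (k n)! * n ! := by
        rw [div_mul_eq_mul_div, le_div_iff₀ (by positivity)]
        exact hmain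
    _ ≤ (1 / 2) ^ k n * n ! := by
        gcongr
        exact choose_sq_div_factorial_le hn hcube

/-! ### Twins as sets of pairs of positions -/

/-- A set of pairs of positions whose first and second coordinates, read from left to right,
are the positions of twins in `σ`. -/
def IsTwinSet {n : ℕ} (σ : Perm (Fin n)) (S : Finset (Fin n × Fin n)) : Prop :=
  ∀ x ∈ S, ∀ y ∈ S,
    (x.1 < y.1 ↔ x.2 < y.2) ∧ (σ x.1 < σ y.1 ↔ σ x.2 < σ y.2) ∧ x.1 ≠ y.2

theorem IsTwinSet.subset {n : ℕ} {σ : Perm (Fin n)} {S S' : Finset (Fin n × Fin n)}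
    (h : IsTwinSet σ S) (hS : S' ⊆ S) : IsTwinSet σ S' :=
  fun x hx y hy => h x (hS hx) y (hS hy)

theorem IsTwinSet.eq_of_fst {n : ℕ} {σ : Perm (Fin n)} {S : Finset (Fin n × Fin n)}
    (h : IsTwinSet σ S) {x y : Fin n × Fin n} (hx : x ∈ S) (hy : y ∈ S) (e : x.1 = y.1) :
    x = y := by
  have h1 := (h x hx y hy).1
  have h2 := (h y hy x hx).1
  refine Prod.ext e (le_antisymm ?_ ?_)
  · exact not_lt.mp fun hlt => (h2.mpr hlt).ne e.symm
  · exact not_lt.mp fun hlt => (h1.mpr hlt).ne e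

theorem IsTwinSet.eq_of_snd {n : ℕ} {σ : Perm (Fin n)} {S : Finset (Fin n × Fin n)}
    (h : IsTwinSet σ S) {x y : Fin n × Fin n} (hx : x ∈ S) (hy : y ∈ S) (e : x.2 = y.2) :
    x = y := by
  have h1 := (h x hx y hy).1
  have h2 := (h y hy x hx).1
  refine Prod.ext (le_antisymm ?_ ?_) e
  · exact not_lt.mp fun hlt => (h2.mp hlt).ne e.symm
  · exact not_lt.mp fun hlt => (h1.mp hlt).ne e

theorem IsTwinSet.hasTwins {n : ℕ} {σ : Perm (Fin n)} {S : Finset (Fin n × Fin n)}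
    (h : IsTwinSet σ S) : HasTwins σ #S := by
  have hcard : #(S.image Prod.fst) = #S :=
    Finset.card_image_of_injOn fun x hx y hy e => h.eq_of_fst hx hy e
  set f := (S.image Prod.fst).orderEmbOfFin hcard with hf
  have hex : ∀ i, ∃ q, (f i, q) ∈ S := by
    intro i
    obtain ⟨x, hx, hxe⟩ := Finset.mem_image.mp ((S.image Prod.fst).orderEmbOfFin_mem hcard i)
    exact ⟨x.2, by rw [hf, ← hxe]; exact hx⟩
  choose g hg using hex
  refine ⟨fun i => σ (f i), fun i => σ (g i),
    ⟨⟨f, f.strictMono, fun _ => rfl⟩, ⟨g, fun i j hij => ?_, fun _ => rfl⟩, fun i j => ?_,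
      fun i j he => ?_⟩⟩
  · exact (h _ (hg i) _ (hg j)).1.mp (f.strictMono hij)
  · exact (h _ (hg i) _ (hg j)).2.1
  · exact (h _ (hg i) _ (hg j)).2.2 (σ.injective he)

/-- Both projections of a twin set are injective, and their images are disjoint. -/
theorem IsTwinSet.card_filter_eq_or_eq_le {n : ℕ} {σ : Perm (Fin n)}
    {S : Finset (Fin n × Fin n)} (h : IsTwinSet σ S) (a : Fin n) :
    #{x ∈ S | σ x.1 = a ∨ σ x.2 = a} ≤ 1 := by
  rw [Finset.card_le_one]
  intro x hx y hy
  simp only [Finset.mem_filter] at hx hy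
  obtain ⟨hx, hxa⟩ := hx
  obtain ⟨hy, hya⟩ := hy
  rcases hxa with hxa | hxa <;> rcases hya with hya | hya <;>
    have e := σ.injective (hxa.trans hya.symm)
  · exact h.eq_of_fst hx hy e
  · exact absurd e (h x hx y hy).2.2
  · exact absurd e.symm (h y hy x hx).2.2
  · exact h.eq_of_snd hx hy e

/-- Delete the at most two pairs that use `a` or `b`; the swap fixes all other symbols. -/
theorem IsTwinSet.exists_swap_mul {n : ℕ} {σ : Perm (Fin n)} {S : Finset (Fin n × Fin n)}
    (h : IsTwinSet σ S) (a b : Fin n) :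
    ∃ S', IsTwinSet (swap a b * σ) S' ∧ #S ≤ #S' + 2 := by
  set A : Finset (Fin n × Fin n) := {x ∈ S | σ x.1 = a ∨ σ x.2 = a}
  set B : Finset (Fin n × Fin n) := {x ∈ S | σ x.1 = b ∨ σ x.2 = b}
  refine ⟨S \ (A ∪ B), ?_, ?_⟩
  · have hfix : ∀ x ∈ S \ (A ∪ B), (swap a b * σ) x.1 = σ x.1 ∧ (swap a b * σ) x.2 = σ x.2 := by
      intro x hx
      simp only [A, B, Finset.mem_sdiff, Finset.mem_union, Finset.mem_filter, not_or,
        not_and] at hx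
      obtain ⟨hxS, hA, hB⟩ := hx
      have hA := hA hxS
      have hB := hB hxS
      exact ⟨swap_apply_of_ne_of_ne hA.1 hB.1, swap_apply_of_ne_of_ne hA.2 hB.2⟩
    intro x hx y hy
    rw [(hfix x hx).1, (hfix x hx).2, (hfix y hy).1, (hfix y hy).2]
    exact h.subset Finset.sdiff_subset x hx y hy
  · have h1 : #S ≤ #(S \ (A ∪ B)) + #(A ∪ B) := by
      rw [← Nat.sub_le_iff_le_add]
      exact Finset.le_card_sdiff _ _
    have h2 := Finset.card_union_le A B
    have hA : #A ≤ 1 := h.card_filter_eq_or_eq_le a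
    have hB : #B ≤ 1 := h.card_filter_eq_or_eq_le b
    omega

open scoped Classical in
/-- The length of the longest twins in `σ`. -/
noncomputable def twinNumber {n : ℕ} (σ : Perm (Fin n)) : ℕ :=
  ({S | IsTwinSet σ S} : Finset (Finset (Fin n × Fin n))).sup card

theorem IsTwinSet.card_le_twinNumber {n : ℕ} {σ : Perm (Fin n)} {S : Finset (Fin n × Fin n)}
    (h : IsTwinSet σ S) : #S ≤ twinNumber σ := by
  classical
  exact Finset.le_sup (f := card) (by simpa using h)

theorem exists_isTwinSet_card_eq {n : ℕ} (σ : Perm (Fin n)) :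
    ∃ S, IsTwinSet σ S ∧ #S = twinNumber σ := by
  classical
  have hne : ({S | IsTwinSet σ S} : Finset (Finset (Fin n × Fin n))).Nonempty :=
    ⟨∅, by simp [IsTwinSet]⟩
  obtain ⟨S, hS, he⟩ := Finset.exists_mem_eq_sup _ hne card
  exact ⟨S, by simpa using hS, by rw [twinNumber, he]⟩

theorem hasTwins_twinNumber {n : ℕ} (σ : Perm (Fin n)) : HasTwins σ (twinNumber σ) := by
  obtain ⟨S, hS, he⟩ := exists_isTwinSet_card_eq σ
  exact he ▸ hS.hasTwins

theorem twinNumber_le_swap_mul {n : ℕ} (a b : Fin n) (σ : Perm (Fin n)) :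
    twinNumber σ ≤ twinNumber (swap a b * σ) + 2 := by
  obtain ⟨S, hS, he⟩ := exists_isTwinSet_card_eq σ
  obtain ⟨S', hS', hle⟩ := hS.exists_swap_mul a b
  have := hS'.card_le_twinNumber
  omega

theorem abs_twinNumber_swap_mul_sub_le {n : ℕ} (a b : Fin n) (σ : Perm (Fin n)) :
    |(twinNumber (swap a b * σ) : ℝ) - twinNumber σ| ≤ 2 := by
  have h1 := twinNumber_le_swap_mul a b σ
  have h2 := twinNumber_le_swap_mul a b (swap a b * σ)
  rw [swap_mul_self_mul] at h2
  have h1' : (twinNumber σ : ℝ) ≤ twinNumber (swap a b * σ) + 2 := by exact_mod_cast h1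
  have h2' : (twinNumber (swap a b * σ) : ℝ) ≤ twinNumber σ + 2 := by exact_mod_cast h2
  rw [abs_le]
  constructor <;> linarith

/-! ### Pairs of entries in a common cell of a grid

Positions and symbols are divided into blocks of length `w`, which divides the permutation
matrix into square cells. -/

section Grid

variable {n : ℕ}

/-- `i` and `j` lie in the same block of length `w`. -/
def SameBlock (w : ℕ) (i j : Fin n) : Prop := (i : ℕ) / w = (j : ℕ) / w

instance (w : ℕ) (i j : Fin n) : Decidable (SameBlock w i j) :=
  inferInstanceAs (Decidable ((i : ℕ) / w = (j : ℕ) / w))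

theorem SameBlock.symm {w : ℕ} {i j : Fin n} (h : SameBlock w i j) : SameBlock w j i := Eq.symm h

theorem SameBlock.trans {w : ℕ} {i j k : Fin n} (h : SameBlock w i j) (h' : SameBlock w j k) :
    SameBlock w i k := Eq.trans h h'

theorem SameBlock.lt_iff_lt {w : ℕ} {i j k l : Fin n} (h : SameBlock w i j)
    (h' : SameBlock w k l) (hne : ¬ SameBlock w i k) : i < k ↔ j < l := by
  have key : ∀ {a b : Fin n}, ¬ SameBlock w a b → (a < b ↔ (a : ℕ) / w < (b : ℕ) / w) := by
    intro a b hab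
    constructor
    · intro hlt
      exact lt_of_le_of_ne (Nat.div_le_div_right (Fin.lt_def.mp hlt).le) hab
    · intro hlt
      exact Fin.lt_def.mpr (not_le.mp fun hle => (Nat.div_le_div_right hle).not_gt hlt)
  have hne' : ¬ SameBlock w j l := fun hjl => hne (h.trans (hjl.trans h'.symm))
  rw [key hne, key hne', ← h, ← h']

/-- The pairs of positions of two entries of `σ` in a common cell. -/
def cellPairs (w : ℕ) (σ : Perm (Fin n)) : Finset (Fin n × Fin n) :=
  {x | x.1 < x.2 ∧ SameBlock w x.1 x.2 ∧ SameBlock w (σ x.1) (σ x.2)}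

/-- The elements of `cellPairs w σ` whose row and column meet no other such pair. -/
def isolatedPairs (w : ℕ) (σ : Perm (Fin n)) : Finset (Fin n × Fin n) :=
  {x ∈ cellPairs w σ | ∀ y ∈ cellPairs w σ, y ≠ x →
    ¬ SameBlock w x.1 y.1 ∧ ¬ SameBlock w (σ x.1) (σ y.1)}

theorem isTwinSet_isolatedPairs (w : ℕ) (σ : Perm (Fin n)) : IsTwinSet σ (isolatedPairs w σ) := by
  intro x hx y hy
  simp only [isolatedPairs, Finset.mem_filter] at hx hy
  have hxc := hx.1
  have hyc := hy.1
  simp only [cellPairs, Finset.mem_filter, Finset.mem_univ, true_and] at hxc hyc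
  by_cases hxy : y = x
  · subst hxy
    simpa using hxc.1.ne
  · obtain ⟨h1, h2⟩ := hx.2 y hy.1 hxy
    exact ⟨hxc.2.1.lt_iff_lt hyc.2.1 h1, hxc.2.2.lt_iff_lt hyc.2.2 h2,
      fun e => h1 (show SameBlock w x.1 y.1 from e ▸ hyc.2.1.symm)⟩

/-- The ordered pairs in a common block. -/
noncomputable def blockPairs (n w : ℕ) : Finset (Fin 2 ↪ Fin n) := {g | SameBlock w (g 0) (g 1)}

/-- The increasing pairs in a common block. -/
noncomputable def blockPairsLT (n w : ℕ) : Finset (Fin 2 ↪ Fin n) :=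
  {g | g 0 < g 1 ∧ SameBlock w (g 0) (g 1)}

/-- The triples in a common block. -/
noncomputable def blockTriples (n w : ℕ) : Finset (Fin 3 ↪ Fin n) :=
  {g | SameBlock w (g 0) (g 1) ∧ SameBlock w (g 0) (g 2)}

/-- The quadruples in a common block. -/
noncomputable def blockQuadruples (n w : ℕ) : Finset (Fin 4 ↪ Fin n) :=
  {g | SameBlock w (g 0) (g 1) ∧ SameBlock w (g 0) (g 2) ∧ SameBlock w (g 0) (g 3)}

/-- The quadruples consisting of two pairs, each in a common block. -/
noncomputable def blockPairPairs (n w : ℕ) : Finset (Fin 4 ↪ Fin n) :=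
  {g | SameBlock w (g 0) (g 1) ∧ SameBlock w (g 2) (g 3)}

/-- Only positions are required to increase, so each pair of entries is counted once, whatever the
order of its symbols. -/
theorem card_filter_blockPairsLT_le (w : ℕ) (σ : Perm (Fin n)) :
    #{g ∈ blockPairsLT n w | σ • g ∈ blockPairs n w} ≤ #(cellPairs w σ) := by
  refine Finset.card_le_card_of_injOn (fun g => (g 0, g 1)) ?_ ?_
  · intro g hg
    simpa [blockPairsLT, blockPairs, cellPairs, and_assoc] using hg
  · intro g _ g' _ he
    simp only [Prod.mk.injEq] at he
    ext i
    fin_cases i <;> simp [he]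

theorem exists_embedding_three {α : Type*} {a b c : α} (hab : a ≠ b) (hac : a ≠ c)
    (hbc : b ≠ c) : ∃ g : Fin 3 ↪ α, g 0 = a ∧ g 1 = b ∧ g 2 = c := by
  refine ⟨⟨![a, b, c], fun i j h => ?_⟩, rfl, rfl, rfl⟩
  fin_cases i <;> fin_cases j <;> simp_all

theorem exists_embedding_four {α : Type*} {a b c d : α} (hab : a ≠ b) (hac : a ≠ c)
    (had : a ≠ d) (hbc : b ≠ c) (hbd : b ≠ d) (hcd : c ≠ d) :
    ∃ g : Fin 4 ↪ α, g 0 = a ∧ g 1 = b ∧ g 2 = c ∧ g 3 = d := by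
  refine ⟨⟨![a, b, c, d], fun i j h => ?_⟩, rfl, rfl, rfl, rfl⟩
  fin_cases i <;> fin_cases j <;> simp_all

/-- A conflicting pair either shares an entry, giving three entries in one cell, or is disjoint,
giving four entries with all positions, or all symbols, in one block. -/
theorem cellPairs_sdiff_isolatedPairs_subset (w : ℕ) (σ : Perm (Fin n)) :
    cellPairs w σ \ isolatedPairs w σ ⊆
      ({g ∈ blockTriples n w | σ • g ∈ blockTriples n w}.image fun g => (g 0, g 1)) ∪
      (({g ∈ blockQuadruples n w | σ • g ∈ blockPairPairs n w}.image fun g => (g 0, g 1)) ∪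
      ({g ∈ blockPairPairs n w | σ • g ∈ blockQuadruples n w}.image fun g => (g 0, g 1))) := by
  rintro ⟨a, b⟩ hx
  simp only [isolatedPairs, Finset.mem_sdiff, Finset.mem_filter, not_and, not_forall] at hx
  obtain ⟨hxc, hx⟩ := hx
  obtain ⟨⟨c, d⟩, hyc, hyx, hxy⟩ := hx hxc
  simp only [cellPairs, Finset.mem_filter, Finset.mem_univ, true_and] at hxc hyc
  obtain ⟨hab, hab1, hab2⟩ := hxc
  obtain ⟨hcd, hcd1, hcd2⟩ := hyc
  simp only [Finset.mem_union, Finset.mem_image, Finset.mem_filter, blockTriples,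
    blockQuadruples, blockPairPairs, Finset.mem_univ, true_and, Function.Embedding.smul_apply,
    Perm.smul_def]
  have triple : ∀ k, a ≠ k → b ≠ k → SameBlock w a k → SameBlock w (σ a) (σ k) →
      ∃ g : Fin 3 ↪ Fin n, ((SameBlock w (g 0) (g 1) ∧ SameBlock w (g 0) (g 2)) ∧
        SameBlock w (σ (g 0)) (σ (g 1)) ∧ SameBlock w (σ (g 0)) (σ (g 2))) ∧
        (g 0, g 1) = (a, b) := by
    intro k hak hbk h1 h2
    obtain ⟨g, rfl, rfl, rfl⟩ := exists_embedding_three hab.ne hak hbk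
    exact ⟨g, ⟨⟨hab1, h1⟩, hab2, h2⟩, rfl⟩
  by_cases hac : a = c
  · subst hac
    have hbd : b ≠ d := fun e => hyx (by rw [e])
    exact Or.inl (triple d hcd.ne hbd hcd1 hcd2)
  by_cases had : a = d
  · subst had
    exact Or.inl (triple c hac (hcd.trans hab).ne' hcd1.symm hcd2.symm)
  by_cases hbc : b = c
  · subst hbc
    exact Or.inl (triple d had hcd.ne (hab1.trans hcd1) (hab2.trans hcd2))
  by_cases hbd : b = d
  · subst hbd
    exact Or.inl (triple c hac hbc (hab1.trans hcd1.symm) (hab2.trans hcd2.symm))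
  obtain ⟨g, rfl, rfl, rfl, rfl⟩ := exists_embedding_four hab.ne hac had hbc hbd hcd.ne
  by_cases h1 : SameBlock w (g 0) (g 2)
  · exact Or.inr (Or.inl ⟨g, ⟨⟨hab1, h1, h1.trans hcd1⟩, hab2, hcd2⟩, rfl⟩)
  · have h2 : SameBlock w (σ (g 0)) (σ (g 2)) := by
      by_contra h2
      exact hxy h1 h2
    exact Or.inr (Or.inr ⟨g, ⟨⟨hab1, hcd1⟩, hab2, h2, h2.trans hcd2⟩, rfl⟩)

theorem card_filter_blockPairsLT_le_twinNumber_add (w : ℕ) (σ : Perm (Fin n)) :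
    #{g ∈ blockPairsLT n w | σ • g ∈ blockPairs n w} ≤ twinNumber σ +
      (#{g ∈ blockTriples n w | σ • g ∈ blockTriples n w} +
      (#{g ∈ blockQuadruples n w | σ • g ∈ blockPairPairs n w} +
      #{g ∈ blockPairPairs n w | σ • g ∈ blockQuadruples n w})) := by
  have h1 := card_filter_blockPairsLT_le w σ
  have h2 := (isTwinSet_isolatedPairs w σ).card_le_twinNumber
  have h3 : #(cellPairs w σ) ≤ #(cellPairs w σ \ isolatedPairs w σ) + #(isolatedPairs w σ) := by
    rw [← Nat.sub_le_iff_le_add]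
    exact Finset.le_card_sdiff _ _
  have h4 := (Finset.card_le_card (cellPairs_sdiff_isolatedPairs_subset w σ)).trans
    ((Finset.card_union_le _ _).trans (add_le_add Finset.card_image_le
      ((Finset.card_union_le _ _).trans (add_le_add Finset.card_image_le
        Finset.card_image_le))))
  omega

/-! ### Counting tuples in common blocks -/

theorem SameBlock.eq_of_mod_eq {w : ℕ} {i j : Fin n} (h : SameBlock w i j)
    (hm : (i : ℕ) % w = (j : ℕ) % w) : i = j := by
  rw [Fin.ext_iff, ← Nat.div_add_mod (i : ℕ) w, ← Nat.div_add_mod (j : ℕ) w, hm, h]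

/-- Within the block of a known element, an element is determined by its residue modulo `w`. The
next two bounds use the same encoding. -/
theorem card_blockTriples_le (n : ℕ) {w : ℕ} (hw : 0 < w) : #(blockTriples n w) ≤ n * w ^ 2 := by
  have hcard : #((univ : Finset (Fin n)) ×ˢ (range w ×ˢ range w)) = n * w ^ 2 := by
    simp [sq]
  rw [← hcard]
  refine Finset.card_le_card_of_injOn (fun g => (g 0, ((g 1 : ℕ) % w, (g 2 : ℕ) % w))) ?_ ?_
  · intro g _
    simp [Nat.mod_lt _ hw]
  · intro g hg g' hg' he
    simp only [Finset.mem_coe, blockTriples, Finset.mem_filter, Finset.mem_univ, true_and]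
      at hg hg'
    simp only [Prod.mk.injEq] at he
    obtain ⟨e0, e1, e2⟩ := he
    rw [e0] at hg
    have e1 := (hg.1.symm.trans hg'.1).eq_of_mod_eq e1
    have e2 := (hg.2.symm.trans hg'.2).eq_of_mod_eq e2
    ext i
    fin_cases i <;> simp [e0, e1, e2]

theorem card_blockQuadruples_le (n : ℕ) {w : ℕ} (hw : 0 < w) :
    #(blockQuadruples n w) ≤ n * w ^ 3 := by
  have hcard : #((univ : Finset (Fin n)) ×ˢ (range w ×ˢ (range w ×ˢ range w))) = n * w ^ 3 := by
    simp [pow_succ, mul_assoc]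
  rw [← hcard]
  refine Finset.card_le_card_of_injOn
    (fun g => (g 0, ((g 1 : ℕ) % w, ((g 2 : ℕ) % w, (g 3 : ℕ) % w)))) ?_ ?_
  · intro g _
    simp [Nat.mod_lt _ hw]
  · intro g hg g' hg' he
    simp only [Finset.mem_coe, blockQuadruples, Finset.mem_filter, Finset.mem_univ, true_and]
      at hg hg'
    simp only [Prod.mk.injEq] at he
    obtain ⟨e0, e1, e2, e3⟩ := he
    rw [e0] at hg
    have e1 := (hg.1.symm.trans hg'.1).eq_of_mod_eq e1
    have e2 := (hg.2.1.symm.trans hg'.2.1).eq_of_mod_eq e2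
    have e3 := (hg.2.2.symm.trans hg'.2.2).eq_of_mod_eq e3
    ext i
    fin_cases i <;> simp [e0, e1, e2, e3]

theorem card_blockPairPairs_le (n : ℕ) {w : ℕ} (hw : 0 < w) :
    #(blockPairPairs n w) ≤ n ^ 2 * w ^ 2 := by
  have hcard : #(((univ : Finset (Fin n)) ×ˢ range w) ×ˢ
      ((univ : Finset (Fin n)) ×ˢ range w)) = n ^ 2 * w ^ 2 := by
    simp only [Finset.card_product, Finset.card_univ, Fintype.card_fin, Finset.card_range]
    ring
  rw [← hcard]
  refine Finset.card_le_card_of_injOn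
    (fun g => ((g 0, (g 1 : ℕ) % w), (g 2, (g 3 : ℕ) % w))) ?_ ?_
  · intro g _
    simp [Nat.mod_lt _ hw]
  · intro g hg g' hg' he
    simp only [Finset.mem_coe, blockPairPairs, Finset.mem_filter, Finset.mem_univ, true_and]
      at hg hg'
    simp only [Prod.mk.injEq] at he
    obtain ⟨⟨e0, e1⟩, e2, e3⟩ := he
    rw [e0, e2] at hg
    have e1 := (hg.1.symm.trans hg'.1).eq_of_mod_eq e1
    have e3 := (hg.2.symm.trans hg'.2).eq_of_mod_eq e3
    ext i
    fin_cases i <;> simp [e0, e1, e2, e3]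

theorem card_blockPairs_le_two_mul (n w : ℕ) : #(blockPairs n w) ≤ 2 * #(blockPairsLT n w) := by
  have hsub : blockPairs n w ⊆ blockPairsLT n w ∪
      (blockPairsLT n w).image fun g => (swap (0 : Fin 2) 1).toEmbedding.trans g := by
    intro g hg
    simp only [blockPairs, Finset.mem_filter, Finset.mem_univ, true_and] at hg
    rcases lt_or_gt_of_ne (g.injective.ne (show (0 : Fin 2) ≠ 1 by decide)) with h | h
    · exact Finset.mem_union_left _ (by simp [blockPairsLT, h, hg])
    · refine Finset.mem_union_right _ (Finset.mem_image.mpr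
        ⟨(swap (0 : Fin 2) 1).toEmbedding.trans g, ?_, ?_⟩)
      · simp [blockPairsLT, h, hg.symm]
      · ext i
        simp
  have h1 := (Finset.card_le_card hsub).trans (Finset.card_union_le _ _)
  have h2 : #((blockPairsLT n w).image fun g => (swap (0 : Fin 2) 1).toEmbedding.trans g)
      ≤ #(blockPairsLT n w) := Finset.card_image_le
  omega

/-- Only the last block can be incomplete, so every `i < n - w` has a full block of `w` partners;
the term `n` pays for the diagonal. -/
theorem le_card_blockPairs (n w : ℕ) : (n - w) * w ≤ n + #(blockPairs n w) := by
  have h1 : (n - w) * w ≤ #{x : Fin n × Fin n | SameBlock w x.1 x.2} := by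
    have hcard : #((univ : Finset (Fin (n - w))) ×ˢ (univ : Finset (Fin w))) = (n - w) * w := by
      simp
    rw [← hcard]
    have hlt : ∀ (i : Fin (n - w)) (s : Fin w), (i : ℕ) / w * w + s < n := by
      intro i s
      have := Nat.div_mul_le_self (i : ℕ) w
      omega
    refine Finset.card_le_card_of_injOn
      (fun x => (⟨x.1, by omega⟩, ⟨(x.1 : ℕ) / w * w + x.2, hlt x.1 x.2⟩)) ?_ ?_
    · rintro ⟨i, s⟩ _
      have hw : 0 < w := s.pos
      simp only [Finset.coe_filter, Finset.mem_univ, true_and, Set.mem_ofPred_eq]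
      have hdiv : (i : ℕ) / w = ((i : ℕ) / w * w + s) / w := by
        rw [mul_comm, Nat.mul_add_div hw, Nat.div_eq_of_lt s.isLt, add_zero]
      exact hdiv
    · rintro ⟨i, s⟩ _ ⟨i', s'⟩ _ he
      simp only [Prod.mk.injEq, Fin.mk.injEq] at he
      obtain ⟨e1, e2⟩ := he
      have e1 := Fin.ext e1
      subst e1
      exact Prod.ext rfl (Fin.ext (by simpa using e2))
  have hsub : ({x : Fin n × Fin n | SameBlock w x.1 x.2} : Finset (Fin n × Fin n)) ⊆
      ((univ : Finset (Fin n)).image fun i => (i, i)) ∪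
        (blockPairs n w).image fun g => (g 0, g 1) := by
    rintro ⟨i, j⟩ hx
    simp only [Finset.mem_filter, Finset.mem_univ, true_and] at hx
    by_cases hij : i = j
    · exact Finset.mem_union_left _ (by simp [hij])
    · refine Finset.mem_union_right _ (Finset.mem_image.mpr
        ⟨⟨![i, j], fun a b h => ?_⟩, ?_, rfl⟩)
      · fin_cases a <;> fin_cases b <;> simp_all
      · simp only [blockPairs, Finset.mem_filter, Finset.mem_univ, true_and]
        exact hx
  refine h1.trans ((Finset.card_le_card hsub).trans ((Finset.card_union_le _ _).trans
    (add_le_add ?_ Finset.card_image_le)))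
  exact Finset.card_image_le.trans (by simp)

end Grid

/-! ### The expected length of the longest twins -/

theorem sum_card_smul_mem_eq_div {r n : ℕ} (hr : r ≤ n) (P Q : Finset (Fin r ↪ Fin n)) :
    ∑ σ : Perm (Fin n), (#{g ∈ P | σ • g ∈ Q} : ℝ) = (#P * #Q / n.descFactorial r : ℝ) * n ! := by
  have h := sum_card_smul_mem_mul P Q
  rw [Fintype.card_embedding_eq, Fintype.card_perm, Fintype.card_fin, Fintype.card_fin] at h
  have hpos : (0 : ℝ) < n.descFactorial r := by
    exact_mod_cast Nat.pos_of_ne_zero fun h0 => (Nat.descFactorial_eq_zero_iff_lt.mp h0).not_ge hr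
  rw [div_mul_eq_mul_div, eq_div_iff hpos.ne']
  have h' : ((∑ σ : Perm (Fin n), #{g ∈ P | σ • g ∈ Q} : ℕ) : ℝ) * n.descFactorial r
      = n ! * (#P * #Q) := by exact_mod_cast h
  push_cast at h'
  rw [h']
  ring

theorem mul_pow_le_descFactorial {n r : ℕ} (hr : r ≤ 4) (hn : 400 ≤ n) :
    (9 / 10 : ℝ) * (n : ℝ) ^ r ≤ n.descFactorial r := by
  have h1 : ((n + 1 - r : ℕ) : ℝ) ^ r ≤ n.descFactorial r := by
    exact_mod_cast Nat.pow_sub_le_descFactorial n r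
  have hn' : (400 : ℝ) ≤ n := by exact_mod_cast hn
  have h2 : (99 / 100 : ℝ) * n ≤ ((n + 1 - r : ℕ) : ℝ) := by
    rw [Nat.cast_sub (by omega)]
    have hr' : (r : ℝ) ≤ 4 := by exact_mod_cast hr
    push_cast
    linarith
  refine le_trans ?_ ((pow_le_pow_left₀ (by positivity) h2 r).trans h1)
  rw [mul_pow]
  gcongr
  calc (9 / 10 : ℝ) ≤ (99 / 100) ^ 4 := by norm_num
    _ ≤ (99 / 100) ^ r := pow_le_pow_of_le_one (by norm_num) (by norm_num) hr

theorem le_sum_twinNumber {n w : ℕ} (hw : 200 ≤ w) (hn : 27 * w ^ 3 ≤ n) :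
    (3 / 10 * (w : ℝ) ^ 2) * n ! ≤ ∑ σ : Perm (Fin n), (twinNumber σ : ℝ) := by
  have hw0 : 0 < w := by omega
  have hwn : 200 * w ≤ n := by nlinarith [Nat.pow_le_pow_left hw 2]
  have hwR : (200 : ℝ) ≤ w := by exact_mod_cast hw
  have hnR : 27 * (w : ℝ) ^ 3 ≤ n := by exact_mod_cast hn
  have hwnR : 200 * (w : ℝ) ≤ n := by exact_mod_cast hwn
  have hw0R : (0 : ℝ) < w := by linarith
  have hn0R : (0 : ℝ) < n := by linarith
  have hw2n : 200 * (w : ℝ) ^ 2 ≤ n := by nlinarith [sq_nonneg (w : ℝ)]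
  -- the main term
  have hQ : (9 / 10 : ℝ) * (n * w) ≤ #(blockPairs n w) := by
    have h : (((n - w : ℕ) : ℝ)) * w ≤ n + #(blockPairs n w) := by
      exact_mod_cast le_card_blockPairs n w
    rw [Nat.cast_sub (by omega)] at h
    nlinarith
  have hP : (#(blockPairs n w) : ℝ) ≤ 2 * #(blockPairsLT n w) := by
    exact_mod_cast card_blockPairs_le_two_mul n w
  have hmain : (405 / 1000 : ℝ) * w ^ 2 ≤
      #(blockPairsLT n w) * #(blockPairs n w) / n.descFactorial 2 := by
    have hd : ((n.descFactorial 2 : ℕ) : ℝ) ≤ (n : ℝ) ^ 2 := by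
      exact_mod_cast Nat.descFactorial_le_pow n 2
    have hd0 : (0 : ℝ) < n.descFactorial 2 :=
      lt_of_lt_of_le (by positivity) (mul_pow_le_descFactorial (r := 2) (by norm_num) (by omega))
    rw [le_div_iff₀ hd0]
    calc (405 / 1000 : ℝ) * w ^ 2 * (n.descFactorial 2 : ℕ)
          ≤ 405 / 1000 * w ^ 2 * (n : ℝ) ^ 2 := by
          gcongr
      _ = (9 / 20 * (n * w)) * (9 / 10 * (n * w) : ℝ) := by ring
      _ ≤ _ := by
          gcongr
          linarith
  -- the error terms
  have hT : (#(blockTriples n w) : ℝ) * #(blockTriples n w) / n.descFactorial 3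
      ≤ 1 / 100 * w ^ 2 := by
    have h : (#(blockTriples n w) : ℝ) ≤ n * w ^ 2 := by
      exact_mod_cast card_blockTriples_le n hw0
    have hd := mul_pow_le_descFactorial (n := n) (r := 3) (by norm_num) (by omega)
    rw [div_le_iff₀ (lt_of_lt_of_le (by positivity) hd)]
    calc (#(blockTriples n w) : ℝ) * #(blockTriples n w) ≤ (n * w ^ 2) * (n * w ^ 2) := by gcongr
      _ = w ^ 2 * n ^ 2 * w ^ 2 := by ring
      _ ≤ w ^ 2 * n ^ 2 * (n / 200) := by gcongr; linarith
      _ ≤ 1 / 100 * w ^ 2 * (9 / 10 * n ^ 3) := by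
          have : (0 : ℝ) ≤ w ^ 2 * n ^ 3 := by positivity
          nlinarith
      _ ≤ _ := by gcongr
  -- This error has the order of the main term, hence the small factor in `27 * w ^ 3 ≤ n`: `(1 /
  -- 27) / (9 / 10) < 42 / 1000`.
  have hF : (#(blockQuadruples n w) : ℝ) * #(blockPairPairs n w) / n.descFactorial 4
      ≤ 42 / 1000 * w ^ 2 := by
    have h : (#(blockQuadruples n w) : ℝ) ≤ n * w ^ 3 := by
      exact_mod_cast card_blockQuadruples_le n hw0
    have h' : (#(blockPairPairs n w) : ℝ) ≤ n ^ 2 * w ^ 2 := by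
      exact_mod_cast card_blockPairPairs_le n hw0
    have hd := mul_pow_le_descFactorial (n := n) (r := 4) (by norm_num) (by omega)
    rw [div_le_iff₀ (lt_of_lt_of_le (by positivity) hd)]
    calc (#(blockQuadruples n w) : ℝ) * #(blockPairPairs n w)
        ≤ (n * w ^ 3) * (n ^ 2 * w ^ 2) := by gcongr
      _ = w ^ 2 * n ^ 3 * w ^ 3 := by ring
      _ ≤ w ^ 2 * n ^ 3 * (n / 27) := by gcongr; linarith
      _ ≤ 42 / 1000 * w ^ 2 * (9 / 10 * n ^ 4) := by
          have : (0 : ℝ) ≤ w ^ 2 * n ^ 4 := by positivity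
          nlinarith
      _ ≤ _ := by gcongr
  have hsum : ∑ σ : Perm (Fin n), (#{g ∈ blockPairsLT n w | σ • g ∈ blockPairs n w} : ℝ) ≤
      ∑ σ : Perm (Fin n), ((twinNumber σ : ℝ) +
        (#{g ∈ blockTriples n w | σ • g ∈ blockTriples n w} +
        (#{g ∈ blockQuadruples n w | σ • g ∈ blockPairPairs n w} +
        #{g ∈ blockPairPairs n w | σ • g ∈ blockQuadruples n w}))) := by
    refine Finset.sum_le_sum fun σ _ => ?_
    exact_mod_cast card_filter_blockPairsLT_le_twinNumber_add w σ
  simp only [Finset.sum_add_distrib] at hsum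
  rw [sum_card_smul_mem_eq_div (by omega), sum_card_smul_mem_eq_div (by omega),
    sum_card_smul_mem_eq_div (by omega), sum_card_smul_mem_eq_div (by omega),
    mul_comm (#(blockPairPairs n w) : ℝ)] at hsum
  -- The quadruple error occurs twice: `0.405 - 0.01 - 2 * 0.042 = 0.311`, above `3 / 10`.
  have hfac : (0 : ℝ) ≤ n ! := by positivity
  have h1 := mul_le_mul_of_nonneg_right hmain hfac
  have h2 := mul_le_mul_of_nonneg_right hT hfac
  have h3 := mul_le_mul_of_nonneg_right hF hfac
  have h4 : (0 : ℝ) ≤ w ^ 2 * n ! := by positivity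
  linarith

theorem eventually_exists_block_length :
    ∀ᶠ n : ℕ in atTop, ∃ w : ℕ, 200 ≤ w ∧ 27 * w ^ 3 ≤ n ∧
      (1 / 40 : ℝ) * (n : ℝ) ^ (2 / 3 : ℝ) ≤ 3 / 10 * (w : ℝ) ^ 2 := by
  have htop : Tendsto (fun n : ℕ => (n : ℝ) ^ (1 / 3 : ℝ)) atTop atTop :=
    (tendsto_rpow_atTop (by norm_num)).comp tendsto_natCast_atTop_atTop
  filter_upwards [htop.eventually_ge_atTop 700] with n hn
  set y := (n : ℝ) ^ (1 / 3 : ℝ) with hy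
  have hy3 : y ^ 3 = n := by
    rw [hy, ← Real.rpow_natCast, ← Real.rpow_mul (by positivity)]
    norm_num
  have hy2 : (n : ℝ) ^ (2 / 3 : ℝ) = y ^ 2 := by
    rw [hy, ← Real.rpow_natCast, ← Real.rpow_mul (by positivity)]
    norm_num
  have hle : (⌊y / 3⌋₊ : ℝ) ≤ y / 3 := Nat.floor_le (by positivity)
  have hlt := Nat.lt_floor_add_one (y / 3)
  refine ⟨⌊y / 3⌋₊, ?_, ?_, ?_⟩
  · exact Nat.le_floor (by push_cast; linarith)
  · have : 27 * (⌊y / 3⌋₊ : ℝ) ^ 3 ≤ n := by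
      calc 27 * (⌊y / 3⌋₊ : ℝ) ^ 3 ≤ 27 * (y / 3) ^ 3 := by gcongr
        _ = (n : ℝ) := by rw [← hy3]; ring
    exact_mod_cast this
  · rw [hy2]
    -- Rounding down costs less than `1`, at most `y / 30` as `y ≥ 700`; then `0.3 * 0.3² = 0.027`
    -- exceeds `1 / 40`.
    have h : 3 / 10 * y ≤ (⌊y / 3⌋₊ : ℝ) := by linarith
    calc (1 / 40 : ℝ) * y ^ 2 ≤ 3 / 10 * (3 / 10 * y) ^ 2 := by nlinarith [sq_nonneg y]
      _ ≤ _ := by gcongr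

theorem holdsAAS_exists_twins :
    HoldsAAS (fun n =>
      {σ | ∃ L : ℕ, (1 / 80 : ℝ) * (n : ℝ) ^ (2 / 3 : ℝ) ≤ (L : ℝ) ∧ HasTwins σ L}) := by
  classical
  have hb : Tendsto (fun n : ℕ => 25600 * (n : ℝ) ^ (-(1 / 3) : ℝ)) atTop (𝓝 0) := by
    have := ((tendsto_rpow_neg_atTop (y := 1 / 3) (by norm_num)).comp
      tendsto_natCast_atTop_atTop).const_mul (25600 : ℝ)
    simpa [Function.comp_def] using this
  refine holdsAAS_of_card_compl_le hb ?_
  filter_upwards [eventually_exists_block_length, eventually_gt_atTop 0] with n hn hn0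
  obtain ⟨w, hw, hwn, hle⟩ := hn
  set t := (1 / 80 : ℝ) * (n : ℝ) ^ (2 / 3 : ℝ) with ht
  have hn0R : (0 : ℝ) < n := by exact_mod_cast hn0
  have ht0 : 0 < t := by positivity
  have hmean : (t + t) * n ! ≤ ∑ σ : Perm (Fin n), (twinNumber σ : ℝ) := by
    refine le_trans ?_ (le_sum_twinNumber hw hwn)
    gcongr
    linarith
  have hvar := card_lt_mul_sq_le n (fun σ => (twinNumber σ : ℝ))
    abs_twinNumber_swap_mul_sub_le ht0.le hmean
  have hsub : ({σ | σ ∉ {σ : Perm (Fin n) | ∃ L : ℕ, t ≤ (L : ℝ) ∧ HasTwins σ L}} :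
      Finset (Perm (Fin n))) ⊆
      ({σ | (twinNumber σ : ℝ) < t} : Finset (Perm (Fin n))) := by
    intro σ hσ
    simp only [Set.mem_ofPred_eq, Finset.mem_filter, Finset.mem_univ, true_and, not_exists,
      not_and] at hσ ⊢
    exact not_le.mp fun h => hσ _ h (hasTwins_twinNumber σ)
  -- Chebyshev's bound is `4n / t²`, and `25600 = 4 * 80²`.
  have ht2 : 25600 * (n : ℝ) ^ (-(1 / 3) : ℝ) * t ^ 2 = 2 ^ 2 * n := by
    have h : (n : ℝ) ^ (-(1 / 3) : ℝ) * ((n : ℝ) ^ (2 / 3 : ℝ)) ^ 2 = n := by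
      rw [← Real.rpow_natCast, ← Real.rpow_mul hn0R.le, ← Real.rpow_add hn0R]
      norm_num
    rw [ht]
    linear_combination 4 * h
  calc _ ≤ (#{σ : Perm (Fin n) | (twinNumber σ : ℝ) < t} : ℝ) := by
        exact_mod_cast Finset.card_le_card hsub
    _ ≤ _ := by
        rw [← mul_le_mul_iff_left₀ (show (0 : ℝ) < t ^ 2 by positivity)]
        calc _ ≤ 2 ^ 2 * (n : ℝ) * n ! := hvar
          _ = _ := by rw [← ht2]; ring

end PermTwins

theorem theorem2 :
    PermTwins.HoldsAAS (fun n =>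
      {σ | ∃ L : ℕ, (1 / 80 : ℝ) * (n : ℝ) ^ (2 / 3 : ℝ) ≤ (L : ℝ) ∧ PermTwins.HasTwins σ L}) ∧
    ∃ C : ℝ, 0 < C ∧ PermTwins.HoldsAAS (fun n =>
      {σ | ∀ L : ℕ, PermTwins.HasTwins σ L → (L : ℝ) ≤ C * (n : ℝ) ^ (2 / 3 : ℝ)}) :=
  ⟨PermTwins.holdsAAS_exists_twins, 6, by norm_num, PermTwins.holdsAAS_twins_length_le⟩
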